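/- For each integer $k\ge 1$ let $F_k:\mathbb{N}\to\mathbb{N}$ be defined by $F_k(0)=0$ and $F_k(n)=n-F_k^k(n-1)$ for $n\ge 1$, where here and below $F_k^m$ denotes the $m$-th iterate of $F_k$ (not a power). Let $\alpha_k$ be the unique positive root of $X^k+X-1$. For $f,g:\mathbb{N}\to\mathbb{N}$ write $f<_\infty g$ (equivalently $g>_\infty f$) if there is $N$ such that $f(n)<g(n)$ for all $n\ge N$. For every $k\ge 1$, $$F_k<_\infty F_{k+1},\qquad F_k^k>_\infty F_{k+1}^{k+1},\qquad F_k^{k+1}>_\infty F_{k+1}^{k+2}.$$ More generally, let $j\ge 0$. For every $k\ge 1$ such that $\alpha_k\ge \frac{j}{j+1}$ we have $F_k^{k+j}>_\infty F_{k+1}^{k+j+1}$; the condition $\alpha_k\ge\frac{j}{j+1}$ holds in particular whenever $k\ge 1$ and $k\ge j^2$. Conversely, for every $k\ge 1$ such that $\alpha_{k+1}\le\frac{j}{j+1}$ we have $F_k^{k+j}<_\infty F_{k+1}^{k+j+1}$; the condition $\alpha_{k+1}\le\frac{j}{j+1}$ holds in particular whenever $1\le k<j$. -/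

import Mathlib

namespace Hofstadter

/-- Course-of-values table: `table k m` holds the values of `F_k` at `0, …, m` (and `0` beyond `m`). -/
def table (k : ℕ) : ℕ → ℕ → ℕ
  | 0 => fun _ => 0
  | m + 1 => Function.update (table k m) (m + 1) (m + 1 - (table k m)^[k] m)

/-- Hofstadter's function `F_k : ℕ → ℕ`, the function with `F_k 0 = 0` and
`F_k n = n - F_k^k (n - 1)` for `n ≥ 1`, where the exponent denotes iteration;
see `F_zero`, `F_succ` and `F_iterate_le` below. -/
def F (k n : ℕ) : ℕ := table k n n

theorem table_eq_F (k : ℕ) {i m : ℕ} (h : i ≤ m) : table k m i = F k i := by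
  induction m, h using Nat.le_induction with
  | base => rfl
  | succ m him ih =>
    rw [table, Function.update_of_ne (by omega), ih]

theorem table_le (k m i : ℕ) : table k m i ≤ i := by
  induction m generalizing i with
  | zero => simp [table]
  | succ m ih =>
    rw [table]
    by_cases h : i = m + 1
    · subst h
      rw [Function.update_self]
      exact Nat.sub_le _ _
    · rw [Function.update_of_ne h]
      exact ih i

theorem F_le (k n : ℕ) : F k n ≤ n := table_le k n n

theorem F_iterate_le (k j n : ℕ) : (F k)^[j] n ≤ n := by
  induction j generalizing n with
  | zero => exact le_rfl
  | succ j ih => exact (ih (F k n)).trans (F_le k n)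

theorem table_iterate_eq (k j : ℕ) {i m : ℕ} (h : i ≤ m) :
    (table k m)^[j] i = (F k)^[j] i := by
  induction j generalizing i with
  | zero => rfl
  | succ j ih =>
    rw [Function.iterate_succ_apply, Function.iterate_succ_apply, table_eq_F k h]
    exact ih ((F_le k i).trans h)

theorem F_zero (k : ℕ) : F k 0 = 0 := rfl

/-- The defining recursion; by `F_iterate_le` the subtraction is never truncated. -/
theorem F_succ (k n : ℕ) : F k (n + 1) = n + 1 - (F k)^[k] n := by
  rw [← table_iterate_eq k k le_rfl, F, table, Function.update_self]

/-- The polynomial `P_k = X^k + X - 1`. -/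
noncomputable def P (k : ℕ) : Polynomial ℝ :=
  Polynomial.X ^ k + Polynomial.X - 1

theorem existsUnique_root_P {k : ℕ} (hk : 1 ≤ k) :
    ∃! x : ℝ, 0 < x ∧ (P k).IsRoot x := by
  have hk0 : k ≠ 0 := by omega
  have hP : ∀ x : ℝ, (P k).IsRoot x ↔ x ^ k + x = 1 := fun x => by
    simp [P, Polynomial.IsRoot, sub_eq_zero]
  simp only [hP]
  have hmono : StrictMonoOn (fun x : ℝ => x ^ k + x) (Set.Ici 0) := fun a ha b _ hab =>
    add_lt_add (pow_lt_pow_left₀ hab ha hk0) hab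
  have hcont : ContinuousOn (fun x : ℝ => x ^ k + x) (Set.Icc 0 1) := by fun_prop
  obtain ⟨x, hx, hx1⟩ : (1 : ℝ) ∈ (fun x : ℝ => x ^ k + x) '' Set.Icc 0 1 :=
    intermediate_value_Icc zero_le_one hcont ⟨by simp [hk0], by simp⟩
  have hx1' : x ^ k + x = 1 := hx1
  have hx0 : 0 < x := by
    refine lt_of_le_of_ne hx.1 fun h => ?_
    rw [← h] at hx1'
    simp [hk0] at hx1'
  exact ⟨x, ⟨hx0, hx1'⟩, fun y hy =>
    hmono.injOn (Set.mem_Ici.2 hy.1.le) (Set.mem_Ici.2 hx0.le) (hy.2.trans hx1'.symm)⟩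

/-- `α k` is, for `k ≥ 1`, the unique positive root of `P_k = X^k + X - 1`
(see `α_spec` and `α_unique`); its value at `k = 0` is irrelevant. -/
noncomputable def α (k : ℕ) : ℝ :=
  Classical.epsilon fun x : ℝ => 0 < x ∧ (P k).IsRoot x

theorem α_spec {k : ℕ} (hk : 1 ≤ k) : 0 < α k ∧ (P k).IsRoot (α k) :=
  Classical.epsilon_spec (existsUnique_root_P hk).exists

theorem α_unique {k : ℕ} (hk : 1 ≤ k) {x : ℝ} (hx : 0 < x) (hr : (P k).IsRoot x) : x = α k :=
  (existsUnique_root_P hk).unique ⟨hx, hr⟩ (α_spec hk)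

/-- `f` is ultimately (strictly) smaller than `g`. -/
def UltimatelyLT (f g : ℕ → ℕ) : Prop :=
  ∃ N : ℕ, ∀ n : ℕ, N ≤ n → f n < g n

end Hofstadter

/-!
The iterates of `F_k`, like `F_k` itself, grow in steps of `0` or `1`, so `F_k n + F_k^k n` is `n`
or `n + 1`. Let `x` be the greatest cluster point of `F_k n / n`, attained along an ultrafilter, and
let `y_j` be the limit of `F_k^j n / n` along that ultrafilter. Then `y_j = y_{j+1} + y_{j+k}`, and
maximality gives `y_{j+1} ≤ x y_j`, with equality at `j = 0`. The recurrence propagates equality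
from `j` to `j + 1`, so `y_j = x^j` and `x + x^k = 1`. The least cluster point satisfies the same
equation, hence `F_k n / n` tends to `α_k` and `F_k^j n / n` to `α_k^j`. It remains to compare
`α_k^{k+j} = α_k^j (1 - α_k)` with its analogue for `k + 1`, using that `x^j (1 - x)` increases up
to `j / (j + 1)` and decreases afterwards.
-/

open Filter Topology Asymptotics Finset

namespace Hofstadter

section RatioLimits

variable {f : ℕ → ℕ} {k : ℕ}

/-- The asymptotic slopes of `f`: the cluster points of `f n / n` as `n → ∞`. -/
def ratioLimits (f : ℕ → ℕ) : Set ℝ :=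
  {x | MapClusterPt x atTop fun n => (f n : ℝ) / n}

theorem div_mem_Icc_of_le_id (hf : f ≤ id) (n : ℕ) : (f n : ℝ) / n ∈ Set.Icc 0 1 :=
  ⟨by positivity, div_le_one_of_le₀ (mod_cast hf n) n.cast_nonneg⟩

theorem ratioLimits_subset_Icc (hf : f ≤ id) : ratioLimits f ⊆ Set.Icc 0 1 := fun _ hx =>
  isClosed_Icc.mem_of_mapClusterPt hx (.of_forall (div_mem_Icc_of_le_id hf))

theorem isCompact_ratioLimits (hf : f ≤ id) : IsCompact (ratioLimits f) :=
  isCompact_Icc.of_isClosed_subset isClosed_setOfPred_clusterPt (ratioLimits_subset_Icc hf)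

theorem ratioLimits_nonempty (hf : f ≤ id) : (ratioLimits f).Nonempty :=
  let ⟨x, _, hx⟩ := isCompact_Icc.exists_mapClusterPt (f := atTop)
    (tendsto_principal.2 (.of_forall (div_mem_Icc_of_le_id hf)))
  ⟨x, hx⟩

theorem exists_tendsto_mem_ratioLimits (hf : f ≤ id) (U : Ultrafilter ℕ) {g : ℕ → ℕ}
    (hg : Tendsto g U atTop) :
    ∃ x ∈ ratioLimits f, Tendsto (fun n => (f (g n) : ℝ) / g n) U (𝓝 x) := by
  obtain ⟨x, -, hx⟩ := isCompact_Icc.ultrafilter_le_nhds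
    (U.map fun n => (f (g n) : ℝ) / g n)
    (tendsto_principal.2 (.of_forall fun n => div_mem_Icc_of_le_id hf (g n)))
  exact ⟨x, .of_comp hg (Tendsto.mapClusterPt hx), hx⟩

theorem tendsto_atTop_of_add_iterate_isEquivalent (hk : k ≠ 0) (hf : f ≤ id)
    (hrec : (fun n => (f n + f^[k] n : ℝ)) ~[atTop] fun n => (n : ℝ)) : Tendsto f atTop atTop := by
  have hiter : ∀ n, f^[k] n ≤ f n := fun n => by
    obtain ⟨i, rfl⟩ := Nat.exists_eq_succ_of_ne_zero hk
    exact Function.iterate_le_id_of_le_id hf i (f n)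
  have hsum := hrec.symm.tendsto_atTop tendsto_natCast_atTop_atTop
  have htwice : Tendsto (fun n => 2 * (f n : ℝ)) atTop atTop :=
    tendsto_atTop_mono (fun n => by linarith [Nat.cast_le (α := ℝ).2 (hiter n)]) hsum
  exact tendsto_natCast_atTop_iff.1 (htwice.atTop_of_const_mul₀ two_pos)

theorem tendsto_iterate_div {l : Filter ℕ} (hl : l ≤ atTop) (hf : Tendsto f atTop atTop)
    {r : ℕ → ℝ} (hr : ∀ j, Tendsto (fun n => (f (f^[j] n) : ℝ) / f^[j] n) l (𝓝 (r j))) (j : ℕ) :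
    Tendsto (fun n => (f^[j] n : ℝ) / n) l (𝓝 (∏ i ∈ range j, r i)) := by
  induction j with
  | zero =>
    refine (tendsto_congr' ?_).2 tendsto_const_nhds
    filter_upwards [hl (eventually_ne_atTop 0)] with n hn
    simp [hn]
  | succ j ih =>
    rw [prod_range_succ]
    refine (ih.mul (hr j)).congr' ?_
    filter_upwards [((hf.iterate j).mono_left hl).eventually_ne_atTop 0] with n hn
    rw [Function.iterate_succ_apply', mul_comm, div_mul_div_cancel₀ (Nat.cast_ne_zero.2 hn)]

theorem exists_iterate_div_limits (hk : k ≠ 0) (hf : f ≤ id)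
    (hrec : (fun n => (f n + f^[k] n : ℝ)) ~[atTop] fun n => (n : ℝ))
    {x : ℝ} (hx : x ∈ ratioLimits f) :
    ∃ y : ℕ → ℝ, y 0 = 1 ∧ y 1 = x ∧ (∀ j, 0 ≤ y j) ∧
      (∀ j, ∃ r ∈ ratioLimits f, y (j + 1) = r * y j) ∧ ∀ j, y j = y (j + 1) + y (j + k) := by
  obtain ⟨U, hU, hUx⟩ := mapClusterPt_iff_ultrafilter.1 hx
  have htop := tendsto_atTop_of_add_iterate_isEquivalent hk hf hrec
  have hiter : ∀ j, Tendsto f^[j] U atTop := fun j => (htop.iterate j).mono_left hU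
  choose r hr hlim using fun j => exists_tendsto_mem_ratioLimits hf U (hiter j)
  have hr0 : r 0 = x := tendsto_nhds_unique (hlim 0) hUx
  refine ⟨fun j => ∏ i ∈ range j, r i, prod_range_zero r, (prod_range_one r).trans hr0,
    fun j => prod_nonneg fun i _ => (ratioLimits_subset_Icc hf (hr i)).1,
    fun j => ⟨r j, hr j, prod_range_succ_comm r j⟩, fun j => ?_⟩
  have hdiv := tendsto_iterate_div hU htop hlim
  have hone : Tendsto (fun n => (f n + f^[k] n : ℝ) / n) atTop (𝓝 1) :=
    (isEquivalent_iff_tendsto_one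
      ((eventually_ne_atTop 0).mono fun n hn => Nat.cast_ne_zero.2 hn)).1 hrec
  have hprod := (hone.comp (hiter j)).mul (hdiv j)
  rw [one_mul] at hprod
  refine tendsto_nhds_unique hprod (((hdiv (j + 1)).add (hdiv (j + k))).congr' ?_)
  filter_upwards [(hiter j).eventually_ne_atTop 0] with n hn
  simp only [Function.comp_apply]
  rw [div_mul_div_cancel₀ (Nat.cast_ne_zero.2 hn), ← Function.iterate_add_apply, add_comm k,
    Function.iterate_succ_apply', add_div]

theorem succ_eq_mul_of_succ_le_mul {y : ℕ → ℝ} {c : ℝ} (hy : ∀ j, y j = y (j + 1) + y (j + k))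
    (hle : ∀ j, y (j + 1) ≤ c * y j) (h0 : y 1 = c * y 0) (j : ℕ) : y (j + 1) = c * y j := by
  induction j with
  | zero => exact h0
  | succ j ih =>
    refine (hle (j + 1)).antisymm ?_
    have hshift := hle (j + k)
    rw [add_right_comm] at hshift
    calc c * y (j + 1) = c * y j - c * y (j + k) := by rw [hy j]; ring
      _ ≤ y (j + 1) - y (j + 1 + k) := by rw [ih]; gcongr
      _ = y (j + 1 + 1) := by rw [hy (j + 1), add_sub_cancel_right]

theorem succ_eq_mul_of_mul_le_succ {y : ℕ → ℝ} {c : ℝ} (hy : ∀ j, y j = y (j + 1) + y (j + k))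
    (hle : ∀ j, c * y j ≤ y (j + 1)) (h0 : y 1 = c * y 0) (j : ℕ) : y (j + 1) = c * y j := by
  have hneg := succ_eq_mul_of_succ_le_mul (y := -y) (c := c) (k := k)
    (fun j => by simp only [Pi.neg_apply]; linarith [hy j])
    (fun j => by simp only [Pi.neg_apply]; linarith [hle j])
    (by simp only [Pi.neg_apply]; linarith) j
  simpa using hneg

theorem pow_add_self_eq_one_of_succ_eq_mul {y : ℕ → ℝ} {c : ℝ} (h0 : y 0 = 1)
    (hy : y 0 = y 1 + y k) (hc : ∀ j, y (j + 1) = c * y j) : c ^ k + c = 1 := by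
  have hpow : ∀ j, y j = c ^ j := fun j => by
    induction j with
    | zero => rw [h0, pow_zero]
    | succ j ih => rw [hc, ih, pow_succ']
  rw [h0, hpow, hpow, pow_one] at hy
  linarith

theorem pow_add_self_eq_one_of_isGreatest (hk : k ≠ 0) (hf : f ≤ id)
    (hrec : (fun n => (f n + f^[k] n : ℝ)) ~[atTop] fun n => (n : ℝ))
    {x : ℝ} (hx : IsGreatest (ratioLimits f) x) : x ^ k + x = 1 := by
  obtain ⟨y, h0, h1, hnonneg, hstep, hy⟩ := exists_iterate_div_limits hk hf hrec hx.1
  have hle : ∀ j, y (j + 1) ≤ x * y j := fun j => by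
    obtain ⟨r, hr, hj⟩ := hstep j
    exact hj.trans_le (mul_le_mul_of_nonneg_right (hx.2 hr) (hnonneg j))
  exact pow_add_self_eq_one_of_succ_eq_mul h0 (by simpa using hy 0)
    (succ_eq_mul_of_succ_le_mul hy hle (by rw [h1, h0, mul_one]))

theorem pow_add_self_eq_one_of_isLeast (hk : k ≠ 0) (hf : f ≤ id)
    (hrec : (fun n => (f n + f^[k] n : ℝ)) ~[atTop] fun n => (n : ℝ))
    {x : ℝ} (hx : IsLeast (ratioLimits f) x) : x ^ k + x = 1 := by
  obtain ⟨y, h0, h1, hnonneg, hstep, hy⟩ := exists_iterate_div_limits hk hf hrec hx.1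
  have hle : ∀ j, x * y j ≤ y (j + 1) := fun j => by
    obtain ⟨r, hr, hj⟩ := hstep j
    exact (mul_le_mul_of_nonneg_right (hx.2 hr) (hnonneg j)).trans_eq hj.symm
  exact pow_add_self_eq_one_of_succ_eq_mul h0 (by simpa using hy 0)
    (succ_eq_mul_of_mul_le_succ hy hle (by rw [h1, h0, mul_one]))

end RatioLimits

section Alpha

variable {k : ℕ} {x : ℝ}

theorem isRoot_P_iff : (P k).IsRoot x ↔ x ^ k + x = 1 := by
  simp [P, Polynomial.IsRoot, sub_eq_zero]

theorem α_pos (hk : 1 ≤ k) : 0 < α k := (α_spec hk).1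

theorem α_pow_add_self (hk : 1 ≤ k) : α k ^ k + α k = 1 := isRoot_P_iff.1 (α_spec hk).2

theorem eq_α_of_pow_add_self_eq_one (hk : 1 ≤ k) (hx : 0 ≤ x) (h : x ^ k + x = 1) : x = α k := by
  refine α_unique hk (hx.lt_of_ne' ?_) (isRoot_P_iff.2 h)
  rintro rfl
  simp [show k ≠ 0 by omega] at h

theorem strictMonoOn_pow_add_self (k : ℕ) :
    StrictMonoOn (fun x : ℝ => x ^ k + x) (Set.Ici 0) := fun _ ha _ _ hab =>
  add_lt_add_of_le_of_lt (pow_le_pow_left₀ ha hab.le k) hab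

theorem le_α_iff (hk : 1 ≤ k) (hx : 0 ≤ x) : x ≤ α k ↔ x ^ k + x ≤ 1 := by
  rw [← α_pow_add_self hk]
  exact ((strictMonoOn_pow_add_self k).le_iff_le hx (α_pos hk).le).symm

theorem α_le_iff (hk : 1 ≤ k) (hx : 0 ≤ x) : α k ≤ x ↔ 1 ≤ x ^ k + x := by
  rw [← α_pow_add_self hk]
  exact ((strictMonoOn_pow_add_self k).le_iff_le (α_pos hk).le hx).symm

theorem α_lt_one (hk : 1 ≤ k) : α k < 1 := by
  linarith [α_pow_add_self hk, pow_pos (α_pos hk) k]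

theorem α_lt_α_succ (hk : 1 ≤ k) : α k < α (k + 1) := by
  refine lt_of_not_ge fun hle => ?_
  have hge : 1 ≤ α k ^ (k + 1) + α k := (α_le_iff k.succ_pos (α_pos hk).le).1 hle
  have hlt : α k ^ (k + 1) < α k ^ k :=
    pow_lt_pow_right_of_lt_one₀ (α_pos hk) (α_lt_one hk) k.lt_succ_self
  linarith [α_pow_add_self hk]

theorem α_pow_add (hk : 1 ≤ k) (j : ℕ) : α k ^ (k + j) = α k ^ j * (1 - α k) := by
  rw [pow_add, eq_sub_of_add_eq (α_pow_add_self hk), mul_comm]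

theorem hasDerivAt_pow_mul_one_sub (j : ℕ) (x : ℝ) :
    HasDerivAt (fun x : ℝ => x ^ (j + 1) * (1 - x)) (x ^ j * ((j + 1) - (j + 2) * x)) x := by
  refine ((hasDerivAt_pow (j + 1) x).mul ((hasDerivAt_id x).const_sub 1)).congr_deriv ?_
  simp only [Nat.add_sub_cancel, id_eq]
  push_cast
  ring

theorem strictMonoOn_pow_mul_one_sub (j : ℕ) :
    StrictMonoOn (fun x : ℝ => x ^ j * (1 - x)) (Set.Icc 0 (j / (j + 1))) := by
  refine strictMonoOn_of_deriv_pos (convex_Icc _ _) (by fun_prop) fun x hx => ?_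
  obtain ⟨h0, h1⟩ := interior_Icc.subset hx
  cases j with
  | zero =>
    rw [Nat.cast_zero, zero_div] at h1
    exact absurd h1 h0.not_gt
  | succ j =>
    rw [(hasDerivAt_pow_mul_one_sub j x).deriv]
    rw [lt_div_iff₀ (by positivity)] at h1
    push_cast at h1
    exact mul_pos (pow_pos h0 _) (by linarith)

theorem strictAntiOn_pow_mul_one_sub (j : ℕ) :
    StrictAntiOn (fun x : ℝ => x ^ j * (1 - x)) (Set.Ici (j / (j + 1))) := by
  refine strictAntiOn_of_deriv_neg (convex_Ici _) (by fun_prop) fun x hx => ?_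
  rw [interior_Ici, Set.mem_Ioi] at hx
  have h0 : 0 < x := lt_of_le_of_lt (by positivity) hx
  cases j with
  | zero => simp
  | succ j =>
    rw [(hasDerivAt_pow_mul_one_sub j x).deriv]
    rw [div_lt_iff₀ (by positivity)] at hx
    push_cast at hx
    exact mul_neg_of_pos_of_neg (pow_pos h0 _) (by linarith)

theorem α_succ_pow_lt_α_pow {j : ℕ} (hk : 1 ≤ k) (h : (j : ℝ) / (j + 1) ≤ α k) :
    α (k + 1) ^ (k + 1 + j) < α k ^ (k + j) := by
  rw [α_pow_add hk, α_pow_add k.succ_pos]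
  have hlt := α_lt_α_succ hk
  exact strictAntiOn_pow_mul_one_sub j h (h.trans hlt.le) hlt

theorem α_pow_lt_α_succ_pow {j : ℕ} (hk : 1 ≤ k) (h : α (k + 1) ≤ (j : ℝ) / (j + 1)) :
    α k ^ (k + j) < α (k + 1) ^ (k + 1 + j) := by
  rw [α_pow_add hk, α_pow_add k.succ_pos]
  have hlt := α_lt_α_succ hk
  exact strictMonoOn_pow_mul_one_sub j ⟨(α_pos hk).le, hlt.le.trans h⟩
    ⟨(α_pos k.succ_pos).le, h⟩ hlt

theorem div_add_one_pow_sq_le (j : ℕ) : ((j : ℝ) / (j + 1)) ^ j ^ 2 ≤ 1 / (j + 1) := by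
  rcases j.eq_zero_or_pos with rfl | hj
  · simp
  have hinv : (j : ℝ) / (j + 1) = (1 + 1 / (j : ℝ))⁻¹ := by field_simp
  have hbernoulli : (j : ℝ) + 1 ≤ (1 + 1 / (j : ℝ)) ^ j ^ 2 := calc
    (j : ℝ) + 1 = 1 + (j ^ 2 : ℕ) * (1 / (j : ℝ)) := by push_cast; field_simp; ring
    _ ≤ (1 + 1 / (j : ℝ)) ^ j ^ 2 :=
      one_add_mul_le_pow ((neg_nonpos.2 zero_le_two).trans (by positivity)) _
  rw [hinv, inv_pow, ← one_div]
  exact one_div_le_one_div_of_le (by positivity) hbernoulli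

theorem one_div_add_one_le_pow (j : ℕ) : 1 / ((j : ℝ) + 1) ≤ ((j : ℝ) / (j + 1)) ^ j := by
  have hx : (0 : ℝ) ≤ j / (j + 1) := by positivity
  calc 1 / ((j : ℝ) + 1) = 1 + j * ((j : ℝ) / (j + 1) - 1) := by field_simp; ring
    _ ≤ ((j : ℝ) / (j + 1)) ^ j := one_add_mul_sub_le_pow (by linarith) j

theorem div_add_one_le_α {j : ℕ} (hk : 1 ≤ k) (h : j ^ 2 ≤ k) : (j : ℝ) / (j + 1) ≤ α k := by
  have hx : (0 : ℝ) ≤ j / (j + 1) := by positivity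
  rw [le_α_iff hk hx]
  have hle : ((j : ℝ) / (j + 1)) ^ k ≤ ((j : ℝ) / (j + 1)) ^ j ^ 2 :=
    pow_le_pow_of_le_one hx (div_le_one_of_le₀ (by linarith) (by positivity)) h
  have hsum : 1 / ((j : ℝ) + 1) + j / (j + 1) = 1 := by field_simp; ring
  linarith [div_add_one_pow_sq_le j]

theorem α_le_div_add_one {j : ℕ} (hk : 1 ≤ k) (h : k ≤ j) : α k ≤ (j : ℝ) / (j + 1) := by
  have hx : (0 : ℝ) ≤ j / (j + 1) := by positivity
  rw [α_le_iff hk hx]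
  have hle : ((j : ℝ) / (j + 1)) ^ j ≤ ((j : ℝ) / (j + 1)) ^ k :=
    pow_le_pow_of_le_one hx (div_le_one_of_le₀ (by linarith) (by positivity)) h
  have hsum : 1 / ((j : ℝ) + 1) + j / (j + 1) = 1 := by field_simp; ring
  linarith [one_div_add_one_le_pow j]

end Alpha

section Limits

variable {k : ℕ}

theorem tendsto_div_α {f : ℕ → ℕ} (hk : 1 ≤ k) (hf : f ≤ id)
    (hrec : (fun n => (f n + f^[k] n : ℝ)) ~[atTop] fun n => (n : ℝ)) :
    Tendsto (fun n => (f n : ℝ) / n) atTop (𝓝 (α k)) := by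
  have hk0 : k ≠ 0 := by omega
  have hcompact := isCompact_ratioLimits hf
  obtain ⟨M, hM⟩ := hcompact.exists_isGreatest (ratioLimits_nonempty hf)
  obtain ⟨m, hm⟩ := hcompact.exists_isLeast (ratioLimits_nonempty hf)
  have hMα : M = α k := eq_α_of_pow_add_self_eq_one hk (ratioLimits_subset_Icc hf hM.1).1
    (pow_add_self_eq_one_of_isGreatest hk0 hf hrec hM)
  have hmα : m = α k := eq_α_of_pow_add_self_eq_one hk (ratioLimits_subset_Icc hf hm.1).1
    (pow_add_self_eq_one_of_isLeast hk0 hf hrec hm)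
  exact isCompact_Icc.tendsto_nhds_of_unique_mapClusterPt
    (.of_forall (div_mem_Icc_of_le_id hf)) fun x _ hx =>
      ((hM.2 hx).trans_eq hMα).antisymm (hmα.symm.trans_le (hm.2 hx))

theorem iterate_succ_eq_or {f : ℕ → ℕ} (hf : f ≤ id) {n : ℕ}
    (hstep : ∀ m ≤ n, f (m + 1) = f m ∨ f (m + 1) = f m + 1) (j : ℕ) :
    f^[j] (n + 1) = f^[j] n ∨ f^[j] (n + 1) = f^[j] n + 1 := by
  induction j with
  | zero => exact .inr rfl
  | succ j ih =>
    simp only [Function.iterate_succ_apply']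
    rcases ih with h | h <;> rw [h]
    · exact .inl rfl
    · exact hstep _ (Function.iterate_le_id_of_le_id hf j n)

theorem F_succ_eq_or (k n : ℕ) : F k (n + 1) = F k n ∨ F k (n + 1) = F k n + 1 := by
  induction n using Nat.strong_induction_on with
  | _ n ih =>
    cases n with
    | zero =>
      rw [F_zero, F_succ]
      omega
    | succ n =>
      have hiter := iterate_succ_eq_or (F_le k) (fun m hm => ih m (Nat.lt_succ_of_le hm)) k
      have hle := F_iterate_le k k n
      rw [F_succ k (n + 1), F_succ k n]
      omega

theorem F_add_iterate_eq_or (k n : ℕ) :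
    F k n + (F k)^[k] n = n ∨ F k n + (F k)^[k] n = n + 1 := by
  cases n with
  | zero => exact .inl (by rw [F_zero, Nat.le_zero.1 (F_iterate_le k k 0)])
  | succ n =>
    have hiter := iterate_succ_eq_or (F_le k) (fun m (_ : m ≤ n) => F_succ_eq_or k m) k
    have hle := F_iterate_le k k n
    rw [F_succ]
    omega

theorem F_add_iterate_isEquivalent (k : ℕ) :
    (fun n => (F k n + (F k)^[k] n : ℝ)) ~[atTop] fun n => (n : ℝ) := by
  have hbound : ∀ n : ℕ, ‖(F k n + (F k)^[k] n - n : ℝ)‖ ≤ ‖(1 : ℝ)‖ := fun n => by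
    rcases F_add_iterate_eq_or k n with h | h <;> rw [← Nat.cast_add, h] <;> simp
  exact ((isBigO_of_le _ hbound).trans_isLittleO
    (isLittleO_const_left.2 (.inr (tendsto_norm_atTop_atTop.comp
      tendsto_natCast_atTop_atTop)))).isEquivalent

theorem tendsto_F_iterate_div (hk : 1 ≤ k) (j : ℕ) :
    Tendsto (fun n => ((F k)^[j] n : ℝ) / n) atTop (𝓝 (α k ^ j)) := by
  have hrec := F_add_iterate_isEquivalent k
  have hlim := tendsto_div_α hk (F_le k) hrec
  have htop := tendsto_atTop_of_add_iterate_isEquivalent (by omega) (F_le k) hrec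
  simpa using tendsto_iterate_div le_rfl htop (fun i => hlim.comp (htop.iterate i)) j

theorem ultimatelyLT_iff_eventually {f g : ℕ → ℕ} :
    UltimatelyLT f g ↔ ∀ᶠ n in atTop, f n < g n :=
  eventually_atTop.symm

theorem ultimatelyLT_of_pow_lt {l i j : ℕ} (hk : 1 ≤ k) (hl : 1 ≤ l)
    (h : α k ^ i < α l ^ j) : UltimatelyLT (F k)^[i] (F l)^[j] := by
  rw [ultimatelyLT_iff_eventually]
  filter_upwards [(tendsto_F_iterate_div hk i).eventually_lt (tendsto_F_iterate_div hl j) h]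
    with n hn
  exact lt_of_not_ge fun hge => hn.not_ge (by gcongr)

theorem F_ultimatelyLT_F_succ (hk : 1 ≤ k) : UltimatelyLT (F k) (F (k + 1)) :=
  ultimatelyLT_of_pow_lt (i := 1) (j := 1) hk k.succ_pos (by simpa using α_lt_α_succ hk)

theorem F_succ_iterate_ultimatelyLT {j : ℕ} (hk : 1 ≤ k) (h : (j : ℝ) / (j + 1) ≤ α k) :
    UltimatelyLT (F (k + 1))^[k + j + 1] (F k)^[k + j] := by
  rw [add_right_comm]
  exact ultimatelyLT_of_pow_lt k.succ_pos hk (α_succ_pow_lt_α_pow hk h)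

theorem F_iterate_ultimatelyLT {j : ℕ} (hk : 1 ≤ k) (h : α (k + 1) ≤ (j : ℝ) / (j + 1)) :
    UltimatelyLT (F k)^[k + j] (F (k + 1))^[k + j + 1] := by
  rw [add_right_comm]
  exact ultimatelyLT_of_pow_lt hk k.succ_pos (α_pow_lt_α_succ_pow hk h)

end Limits

end Hofstadter

theorem corollary6p4 :
    (∀ k : ℕ, 1 ≤ k →
      Hofstadter.UltimatelyLT (Hofstadter.F k) (Hofstadter.F (k + 1)) ∧
      Hofstadter.UltimatelyLT (Hofstadter.F (k + 1))^[k + 1] (Hofstadter.F k)^[k] ∧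
      Hofstadter.UltimatelyLT (Hofstadter.F (k + 1))^[k + 2] (Hofstadter.F k)^[k + 1]) ∧
    (∀ j k : ℕ, 1 ≤ k →
      ((j : ℝ) / ((j : ℝ) + 1) ≤ Hofstadter.α k →
        Hofstadter.UltimatelyLT (Hofstadter.F (k + 1))^[k + j + 1] (Hofstadter.F k)^[k + j]) ∧
      (j ^ 2 ≤ k → (j : ℝ) / ((j : ℝ) + 1) ≤ Hofstadter.α k) ∧
      (Hofstadter.α (k + 1) ≤ (j : ℝ) / ((j : ℝ) + 1) →
        Hofstadter.UltimatelyLT (Hofstadter.F k)^[k + j] (Hofstadter.F (k + 1))^[k + j + 1]) ∧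
      (k < j → Hofstadter.α (k + 1) ≤ (j : ℝ) / ((j : ℝ) + 1))) := by
  refine ⟨fun k hk => ⟨Hofstadter.F_ultimatelyLT_F_succ hk,
      Hofstadter.F_succ_iterate_ultimatelyLT (j := 0) hk ?_,
      Hofstadter.F_succ_iterate_ultimatelyLT (j := 1) hk ?_⟩,
    fun j k hk => ⟨Hofstadter.F_succ_iterate_ultimatelyLT hk, Hofstadter.div_add_one_le_α hk,
      Hofstadter.F_iterate_ultimatelyLT hk, Hofstadter.α_le_div_add_one k.succ_pos⟩⟩
  · exact Hofstadter.div_add_one_le_α hk (by omega)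
  · exact Hofstadter.div_add_one_le_α hk (by omega)
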